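/- **Theorem 1 (Stability of the BDF2 ensemble scheme).** Let $\Omega\subset\mathbb R^d$ ($d=2,3$) be a bounded open set, $X=(H^1_0(\Omega))^d$, $Q=L^2_0(\Omega)$, let $(\cdot,\cdot)$ and $\|\cdot\|$ be the $L^2(\Omega)$ inner product and norm, $\|F\|_{-1}=\sup_{0\ne v\in X}F(v)/\|\nabla v\|$ for bounded linear functionals $F$ on $X$ (written $F(v)=(F,v)$), and $$b^*(u,v,w)=\tfrac12(u\cdot\nabla v,w)-\tfrac12(u\cdot\nabla w,v).$$ For every $C_{inv}>0$ there is a constant $C>0$, depending only on $\Omega$ and $C_{inv}$, such that the following holds. Let $h>0$ and let $X_h\subset X$, $Q_h\subset Q$ be linear subspaces (conforming finite element spaces of mesh size $h$) with the inverse inequality $h\|\nabla v_h\|\le C_{inv}\|v_h\|$ for all $v_h\in X_h$. Let $J\ge1$, $\nu_1,\dots,\nu_J>0$, $\overline\nu=\frac1J\sum_j\nu_j$, $\Delta t>0$, $N\ge2$, let $f_j^{n}$ ($2\le n\le N$) be bounded linear functionals on $X$, and let $u_{j,h}^n\in X_h$ ($0\le n\le N$), $p_{j,h}^n\in Q_h$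 ($2\le n\le N$) satisfy, for $j=1,\dots,J$ and $n=1,\dots,N-1$, $$\Big(\tfrac{3u_{j,h}^{n+1}-4u_{j,h}^{n}+u_{j,h}^{n-1}}{2\Delta t},v_h\Big)+b^*(\overline u_h^n,u_{j,h}^{n+1},v_h)+b^*(u_{j,h}'^{\,n},2u_{j,h}^n-u_{j,h}^{n-1},v_h)-(p_{j,h}^{n+1},\nabla\cdot v_h)$$ $$+\overline\nu(\nabla u_{j,h}^{n+1},\nabla v_h)+(\nu_j-\overline\nu)(\nabla(2u_{j,h}^n-u_{j,h}^{n-1}),\nabla v_h)=(f_j^{n+1},v_h)\quad\forall v_h\in X_h,$$ $$(\nabla\cdot u_{j,h}^{n+1},q_h)=0\quad\forall q_h\in Q_h,$$ where $\overline u_h^n=\frac1J\sum_{j}(2u_{j,h}^n-u_{j,h}^{n-1})$ and $u_{j,h}'^{\,n}=2u_{j,h}^n-u_{j,h}^{n-1}-\overline u_h^n$. Let $j\in\{1,\dots,J\}$, and suppose that for some $0\le\mu<1$ and $0<\epsilon\le2-2\sqrt\mu$ $$C\frac{\Delta t}{\overline\nu h}\|\nabla u_{j,h}'^{\,n}\|^2\le\frac{(2-2\sqrt\mu-\epsilon)\sqrt\mu}{2(\sqrt\mu+\epsilon)}\quad(1\le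 n\le N-1),\qquad \frac{|\nu_j-\overline\nu|}{\overline\nu}\le\frac{\sqrt\mu}{3}.$$ Then, with $K=\frac{\sqrt\mu+\epsilon}{2-\sqrt\mu}\Big(\frac{\sqrt\mu}{2}\frac{2+\epsilon}{\sqrt\mu+\epsilon}-\frac{3|\nu_j-\overline\nu|}{2\overline\nu}\Big)$, $$\tfrac14\big(\|u_{j,h}^N\|^2+\|2u_{j,h}^N-u_{j,h}^{N-1}\|^2\big)+\tfrac18\sum_{n=1}^{N-1}\|u_{j,h}^{n+1}-2u_{j,h}^n+u_{j,h}^{n-1}\|^2+\overline\nu\Delta t\,K\|\nabla u_{j,h}^N\|^2$$ $$\le\sum_{n=1}^{N-1}\frac{\sqrt\mu+\epsilon}{2\epsilon(2-\sqrt\mu)}\frac{\Delta t}{\overline\nu}\|f_j^{n+1}\|_{-1}^2+\tfrac14\big(\|u_{j,h}^1\|^2+\|2u_{j,h}^1-u_{j,h}^0\|^2\big)+\overline\nu\Delta t\,K\|\nabla u_{j,h}^1\|^2+\tfrac12\Delta t\,|\nu_j-\overline\nu|\,\|\nabla u_{j,h}^0\|^2 .$$ -/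

import Mathlib

open MeasureTheory
open scoped ContDiff

noncomputable section

namespace EnsembleNS

/-- `L²(Ω)`, with its inner product `(·,·)` and norm `‖·‖`. -/
abbrev L2 {d : ℕ} (Ω : Set (EuclideanSpace ℝ (Fin d))) :=
  Lp ℝ 2 ((volume : Measure (EuclideanSpace ℝ (Fin d))).restrict Ω)

/-- The pairs `(φ, ∇φ)` with `φ ∈ C_c^∞(Ω)`, as elements of `L²(Ω) × L²(Ω)^d`. -/
def testGraph {d : ℕ} (Ω : Set (EuclideanSpace ℝ (Fin d))) :
    Submodule ℝ (L2 Ω × (Fin d → L2 Ω)) where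
  carrier := {P | ∃ φ : EuclideanSpace ℝ (Fin d) → ℝ,
    ContDiff ℝ ∞ φ ∧ HasCompactSupport φ ∧ tsupport φ ⊆ Ω ∧
    (P.1 : EuclideanSpace ℝ (Fin d) → ℝ) =ᵐ[volume.restrict Ω] φ ∧
    ∀ k, (P.2 k : EuclideanSpace ℝ (Fin d) → ℝ) =ᵐ[volume.restrict Ω]
      fun x => fderiv ℝ φ x (EuclideanSpace.single k 1)}
  zero_mem' := by
    refine ⟨0, contDiff_const, HasCompactSupport.zero, ?_, ?_, ?_⟩
    · have h0 : tsupport (0 : EuclideanSpace ℝ (Fin d) → ℝ) = ∅ := by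
        rw [tsupport_eq_empty_iff]
      rw [h0]
      exact Set.empty_subset _
    · exact Lp.coeFn_zero _ _ _
    · intro k
      filter_upwards [Lp.coeFn_zero ℝ 2
        ((volume : Measure (EuclideanSpace ℝ (Fin d))).restrict Ω)] with x hx
      simpa using hx
  add_mem' := by
    rintro P R ⟨φ, h1, h2, h3, h4, h5⟩ ⟨ψ, g1, g2, g3, g4, g5⟩
    refine ⟨φ + ψ, h1.add g1, h2.add g2, (tsupport_add φ ψ).trans (Set.union_subset h3 g3),
      (Lp.coeFn_add _ _).trans (h4.add g4), fun k => ?_⟩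
    refine (Lp.coeFn_add (P.2 k) (R.2 k)).trans ?_
    filter_upwards [h5 k, g5 k] with x hx gx
    have e := fderiv_add (h1.differentiable (by simp) x) (g1.differentiable (by simp) x)
    simp [e, hx, gx]
  smul_mem' := by
    rintro c P ⟨φ, h1, h2, h3, h4, h5⟩
    refine ⟨c • φ, contDiff_const.smul h1, h2.smul_left (f := fun _ => c),
      (closure_mono (Function.support_const_smul_subset c φ)).trans h3,
      (Lp.coeFn_smul _ _).trans (h4.const_smul c), fun k => ?_⟩
    refine (Lp.coeFn_smul c (P.2 k)).trans ?_
    filter_upwards [h5 k] with x hx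
    have e := fderiv_const_smul (h1.differentiable (by simp) x) c
    simp [e, hx]

/-- `H¹₀(Ω)`, the closure of `C_c^∞(Ω)` in the `H¹` norm. An element is carried together with
its weak gradient, that is as the pair `(v, ∇v) ∈ L²(Ω) × L²(Ω)^d`; the norm of the product
restricts to a norm equivalent to the `H¹` norm. -/
def H10 {d : ℕ} (Ω : Set (EuclideanSpace ℝ (Fin d))) :
    Submodule ℝ (L2 Ω × (Fin d → L2 Ω)) :=
  (testGraph Ω).topologicalClosure

/-- The velocity space `X = H¹₀(Ω)^d`. -/
abbrev Velocity {d : ℕ} (Ω : Set (EuclideanSpace ℝ (Fin d))) := Fin d → H10 Ω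

variable {d : ℕ} {Ω : Set (EuclideanSpace ℝ (Fin d))}

/-- The component `v_i ∈ L²(Ω)`. -/
def comp (v : Velocity Ω) (i : Fin d) : L2 Ω := (v i : L2 Ω × (Fin d → L2 Ω)).1

/-- The weak partial derivative `∂_k v_i ∈ L²(Ω)`. -/
def pder (v : Velocity Ω) (k i : Fin d) : L2 Ω := (v i : L2 Ω × (Fin d → L2 Ω)).2 k

/-- `(u, v)`. -/
def l2Inner (u v : Velocity Ω) : ℝ := ∑ i, inner ℝ (comp u i) (comp v i)

/-- `(∇u, ∇v)`. -/
def gradInner (u v : Velocity Ω) : ℝ := ∑ i, ∑ k, inner ℝ (pder u k i) (pder v k i)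

/-- `‖v‖`. -/
def l2Norm (v : Velocity Ω) : ℝ := √(l2Inner v v)

/-- `‖∇v‖`. -/
def gradNorm (v : Velocity Ω) : ℝ := √(gradInner v v)

/-- `(∇·v, q)`. -/
def divInner (v : Velocity Ω) (q : L2 Ω) : ℝ := ∑ i, inner ℝ (pder v i i) q

/-- `(u·∇v, w)`. -/
def convection (u v w : Velocity Ω) : ℝ :=
  ∫ x in Ω, ∑ i, ∑ k, comp u k x * pder v k i x * comp w i x

/-- The skew-symmetric trilinear form `b*(u, v, w) = ½ (u·∇v, w) - ½ (u·∇w, v)`. -/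
def bStar (u v w : Velocity Ω) : ℝ := 1 / 2 * convection u v w - 1 / 2 * convection u w v

/-- `‖F‖₋₁ = sup_{0 ≠ v ∈ X} F(v) / ‖∇v‖` for `F` in the dual space `H⁻¹(Ω)^d` of `X`. -/
def dualNorm (F : Velocity Ω →L[ℝ] ℝ) : ℝ :=
  sSup {r : ℝ | ∃ v : Velocity Ω, v ≠ 0 ∧ r = F v / gradNorm v}

/-- The mean viscosity. -/
def nuBar {J : ℕ} (ν : Fin J → ℝ) : ℝ := (1 / (J : ℝ)) * ∑ j, ν j

/-- The extrapolation `2 u_j^n - u_j^{n-1}` (for `n ≥ 1`). -/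
def extrap {J : ℕ} (u : Fin J → ℕ → Velocity Ω) (j : Fin J) (n : ℕ) : Velocity Ω :=
  (2 : ℝ) • u j n - u j (n - 1)

/-- The ensemble mean `(1/J) ∑_j (2 u_j^n - u_j^{n-1})`. -/
def uBar {J : ℕ} (u : Fin J → ℕ → Velocity Ω) (n : ℕ) : Velocity Ω :=
  (1 / (J : ℝ)) • ∑ j, extrap u j n

/-- The fluctuation `2 u_j^n - u_j^{n-1}` minus the ensemble mean. -/
def uFluct {J : ℕ} (u : Fin J → ℕ → Velocity Ω) (j : Fin J) (n : ℕ) : Velocity Ω :=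
  extrap u j n - uBar u n

/-- `(u_j^n)_{0 ≤ n ≤ N}` and `(p_j^n)_{2 ≤ n ≤ N}` solve the fully discrete BDF2 ensemble scheme
with time step `Δt`, velocity space `Xh`, pressure space `Qh`, viscosities `ν_j`, forces `f_j^n`
and starting values `u_j^0`, `u_j^1`. -/
structure IsSchemeSolution {J : ℕ} (Xh : Submodule ℝ (Velocity Ω)) (Qh : Submodule ℝ (L2 Ω))
    (ν : Fin J → ℝ) (Δt : ℝ) (f : Fin J → ℕ → (Velocity Ω →L[ℝ] ℝ)) (N : ℕ)
    (u : Fin J → ℕ → Velocity Ω) (p : Fin J → ℕ → L2 Ω) : Prop where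
  velocity_mem : ∀ j n, n ≤ N → u j n ∈ Xh
  pressure_mem : ∀ j n, 2 ≤ n → n ≤ N → p j n ∈ Qh
  momentum : ∀ j n, 1 ≤ n → n + 1 ≤ N → ∀ v ∈ Xh,
    l2Inner ((1 / (2 * Δt)) • ((3 : ℝ) • u j (n + 1) - (4 : ℝ) • u j n + u j (n - 1))) v
      + bStar (uBar u n) (u j (n + 1)) v
      + bStar (uFluct u j n) (extrap u j n) v
      - divInner v (p j (n + 1))
      + nuBar ν * gradInner (u j (n + 1)) v
      + (ν j - nuBar ν) * gradInner (extrap u j n) v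
      = f j (n + 1) v
  incompressible : ∀ j n, 1 ≤ n → n + 1 ≤ N → ∀ q ∈ Qh, divInner (u j (n + 1)) q = 0

end EnsembleNS

end

/-!
The scheme is tested with `u_j^{n+1}` itself. The BDF2 difference quotient then produces the
increment of the energy `¼ (‖u^n‖² + ‖2u^n - u^{n-1}‖²)` plus `¼ ‖w‖²`, where
`w = u^{n+1} - 2u^n + u^{n-1}` (`bdf2_identity`). The pressure and the convection by the ensemble
mean vanish, and by skew-symmetry the convection by the fluctuation `u'` equals
`b*(u', u^{n+1}, w)`, since `2u^n - u^{n-1} = u^{n+1} - w`.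

The analytic input is the bound `|b*(u, v, w)| ≤ M ‖∇u‖ ‖∇v‖ (‖∇w‖ ‖w‖)^{1/2}`
(`IsSobolevConst.exists_abs_bStar_le`); with the inverse inequality it gives
`κ ‖∇u^{n+1}‖ ‖w‖` with `κ² = M² ‖∇u'‖² Cinv / h`, so Young's inequality and the time step condition,
with constant `C = 2 M² Cinv`, absorb the convection into `⅛ ‖w‖²` and the dissipation. The bound
on `b*` leaves room for half a derivative of `w` only, so the term `(u·∇w, v)` of its definition is
first integrated by parts. On `H¹₀(Ω)` this and the bound itself rest on the
Gagliardo–Nirenberg–Sobolev inequality `‖v‖_{L⁶} ≤ C ‖∇v‖`, extended from test functions by lower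
semicontinuity of the `L⁶` norm (`exists_eLpNorm_six_le`), and on Hölder's inequality. The Sobolev
inequality also gives Poincaré's, without which the supremum defining `‖F‖₋₁` need not bound `F`.

What remains is arithmetic (`energy_step`): the force and the viscosity fluctuation take a part of
the dissipation, and the rest is at least `K ‖∇u^{n+1}‖²` with `K ≥ 3 |ν_j - ν̄| / (2 ν̄)`, so that
the energy with the added terms `ν̄ Δt (K ‖∇u^n‖² + |ν_j - ν̄| / (2 ν̄) ‖∇u^{n-1}‖²)` telescopes.
-/

noncomputable section

namespace EnsembleNS

variable {d : ℕ} {Ω : Set (EuclideanSpace ℝ (Fin d))}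

/-! ### The Sobolev inequality on `H¹₀(Ω)` -/

open scoped ENNReal NNReal

lemma opNorm_le_sum_norm_apply_single (T : EuclideanSpace ℝ (Fin d) →L[ℝ] ℝ) :
    ‖T‖ ≤ ∑ k, ‖T (EuclideanSpace.single k 1)‖ := by
  refine T.opNorm_le_bound (Finset.sum_nonneg fun _ _ => norm_nonneg _) fun x => ?_
  have hx : x = ∑ k, x k • EuclideanSpace.single k (1 : ℝ) := by
    ext i
    simp [Finset.sum_apply, Pi.single_apply]
  calc ‖T x‖ = ‖∑ k, x k • T (EuclideanSpace.single k 1)‖ := by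
        conv_lhs => rw [hx]
        simp only [map_sum, map_smul]
    _ ≤ ∑ k, ‖x k • T (EuclideanSpace.single k 1)‖ := norm_sum_le _ _
    _ ≤ ∑ k, ‖T (EuclideanSpace.single k 1)‖ * ‖x‖ := by
        refine Finset.sum_le_sum fun k _ => ?_
        rw [norm_smul, mul_comm]
        gcongr
        exact PiLp.norm_apply_le x k
    _ = _ := (Finset.sum_mul _ _ _).symm

lemma exists_eLpNorm_six_le_of_smooth (hd : d = 2 ∨ d = 3) (hΩb : Bornology.IsBounded Ω) :
    ∃ C : ℝ≥0, ∀ φ : EuclideanSpace ℝ (Fin d) → ℝ, ContDiff ℝ ∞ φ → tsupport φ ⊆ Ω →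
      eLpNorm φ 6 (volume.restrict Ω) ≤
        C * ∑ k, eLpNorm (fun x => fderiv ℝ φ x (EuclideanSpace.single k 1)) 2
          (volume.restrict Ω) := by
  -- The exponent with Sobolev conjugate `6` is `3 / 2` in the plane and `2` in space. As `2` is
  -- critical in the plane, the gradient norm is brought back to `L²` by the finite measure of `Ω`.
  obtain ⟨p, hp1, hp2, hpd, hpq⟩ : ∃ p : ℝ≥0, 1 ≤ p ∧ p ≤ 2 ∧ p < (d : ℝ≥0) ∧
      (p : ℝ)⁻¹ - (d : ℝ)⁻¹ ≤ ((6 : ℝ≥0) : ℝ)⁻¹ := by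
    rcases hd with rfl | rfl
    · refine ⟨3 / 2, ?_, ?_, ?_, ?_⟩ <;>
        first | (rw [← NNReal.coe_le_coe]; norm_num) | (rw [← NNReal.coe_lt_coe]; norm_num) | norm_num
    · refine ⟨2, ?_, ?_, ?_, ?_⟩ <;>
        first | (rw [← NNReal.coe_le_coe]; norm_num) | (rw [← NNReal.coe_lt_coe]; norm_num) | norm_num
  set C₁ := eLpNormLESNormFDerivOfLeConst ℝ
    (volume : Measure (EuclideanSpace ℝ (Fin d))) Ω p 6
  set t : ℝ≥0∞ := (volume.restrict Ω) Set.univ ^ (1 / (p : ℝ≥0∞).toReal - 1 / (2 : ℝ≥0∞).toReal)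
  have hexp : 0 ≤ 1 / (p : ℝ≥0∞).toReal - 1 / (2 : ℝ≥0∞).toReal := by
    have h0 : (0 : ℝ) < p := lt_of_lt_of_le one_pos (by exact_mod_cast hp1)
    have h2 : (p : ℝ) ≤ 2 := by exact_mod_cast hp2
    simp only [ENNReal.coe_toReal, ENNReal.toReal_ofNat, sub_nonneg]
    exact one_div_le_one_div_of_le h0 h2
  have ht : t ≠ ⊤ := by
    refine ENNReal.rpow_ne_top_of_nonneg hexp ?_
    simpa using hΩb.measure_lt_top.ne
  refine ⟨C₁ * t.toNNReal, fun φ hφ hs => ?_⟩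
  have hφ1 : ContDiff ℝ 1 φ := hφ.of_le (by exact_mod_cast le_top)
  have hcont : Continuous (fderiv ℝ φ) := hφ1.continuous_fderiv (by simp)
  have h1 := eLpNorm_le_eLpNorm_fderiv_of_le
    (volume : Measure (EuclideanSpace ℝ (Fin d))) (F := ℝ) (u := φ) (s := Ω) (p := p) (q := 6)
    hφ1 ((subset_tsupport φ).trans hs) hp1 (by simpa using hpd) (by simpa using hpq) hΩb
  calc eLpNorm φ 6 (volume.restrict Ω) ≤ eLpNorm φ 6 volume := eLpNorm_restrict_le _ _ _ _
    _ ≤ C₁ * eLpNorm (fderiv ℝ φ) p volume := by exact_mod_cast h1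
    _ = C₁ * eLpNorm (fderiv ℝ φ) p (volume.restrict Ω) := by
        have hsup : (fun x => ‖fderiv ℝ φ x‖).support ⊆ Ω := fun x hx =>
          hs (support_fderiv_subset ℝ fun h0 => hx (by simp [h0]))
        rw [← eLpNorm_norm (fderiv ℝ φ), ← eLpNorm_norm (fderiv ℝ φ),
          eLpNorm_restrict_eq_of_support_subset hsup]
    _ ≤ C₁ * (eLpNorm (fderiv ℝ φ) 2 (volume.restrict Ω) * t) := by
        gcongr
        exact eLpNorm_le_eLpNorm_mul_rpow_measure_univ (by exact_mod_cast hp2)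
          hcont.aestronglyMeasurable
    _ ≤ C₁ * ((∑ k, eLpNorm (fun x => fderiv ℝ φ x (EuclideanSpace.single k 1)) 2
          (volume.restrict Ω)) * t) := by
        gcongr
        calc eLpNorm (fderiv ℝ φ) 2 (volume.restrict Ω)
            ≤ eLpNorm (fun x => ∑ k, ‖fderiv ℝ φ x (EuclideanSpace.single k 1)‖) 2
              (volume.restrict Ω) := by
              refine eLpNorm_mono_real fun x => opNorm_le_sum_norm_apply_single _
          _ = eLpNorm (∑ k, fun x => ‖fderiv ℝ φ x (EuclideanSpace.single k 1)‖) 2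
              (volume.restrict Ω) := by
              congr 1
              ext x
              simp
          _ ≤ ∑ k, eLpNorm (fun x => ‖fderiv ℝ φ x (EuclideanSpace.single k 1)‖) 2
              (volume.restrict Ω) := by
              refine eLpNorm_sum_le (fun k _ => ?_) (by norm_num)
              exact (hcont.clm_apply continuous_const).norm.aestronglyMeasurable
          _ = _ := by simp only [eLpNorm_norm]
    _ = _ := by
        rw [ENNReal.coe_mul, ENNReal.coe_toNNReal ht]
        ring

lemma exists_seq_testGraph {P : L2 Ω × (Fin d → L2 Ω)} (hP : P ∈ H10 Ω) :
    ∃ s : ℕ → L2 Ω × (Fin d → L2 Ω), (∀ n, s n ∈ testGraph Ω) ∧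
      Filter.Tendsto s Filter.atTop (nhds P) :=
  mem_closure_iff_seq_limit.1 hP

/-- **Sobolev inequality** on `H¹₀(Ω)`. -/
lemma exists_eLpNorm_six_le (hd : d = 2 ∨ d = 3) (hΩb : Bornology.IsBounded Ω) :
    ∃ C : ℝ, 0 < C ∧ ∀ P ∈ H10 Ω,
      eLpNorm P.1 6 (volume.restrict Ω) ≤ ENNReal.ofReal (C * ∑ k, ‖P.2 k‖) := by
  obtain ⟨C, hC⟩ := exists_eLpNorm_six_le_of_smooth hd hΩb
  have key : ∀ P ∈ testGraph Ω,
      eLpNorm P.1 6 (volume.restrict Ω) ≤ ENNReal.ofReal (((C : ℝ) + 1) * ∑ k, ‖P.2 k‖) := by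
    rintro P ⟨φ, h1, -, h3, h4, h5⟩
    have hsum : ∑ k, eLpNorm (fun x => fderiv ℝ φ x (EuclideanSpace.single k 1)) 2
        (volume.restrict Ω) = ENNReal.ofReal (∑ k, ‖P.2 k‖) := by
      rw [ENNReal.ofReal_sum_of_nonneg fun _ _ => norm_nonneg _]
      refine Finset.sum_congr rfl fun k _ => ?_
      rw [← eLpNorm_congr_ae (h5 k), Lp.norm_def, ENNReal.ofReal_toReal (Lp.eLpNorm_ne_top _)]
    calc eLpNorm P.1 6 (volume.restrict Ω) = eLpNorm φ 6 (volume.restrict Ω) :=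
          eLpNorm_congr_ae h4
      _ ≤ C * ENNReal.ofReal (∑ k, ‖P.2 k‖) := hsum ▸ hC φ h1 h3
      _ ≤ ENNReal.ofReal ((C : ℝ) + 1) * ENNReal.ofReal (∑ k, ‖P.2 k‖) := by
          gcongr
          rw [← ENNReal.ofReal_coe_nnreal]
          exact ENNReal.ofReal_le_ofReal (by linarith)
      _ = _ := (ENNReal.ofReal_mul (by positivity)).symm
  refine ⟨C + 1, by positivity, fun P hP => ?_⟩
  obtain ⟨s, hs, hlim⟩ := exists_seq_testGraph hP
  have hlim1 : Filter.Tendsto (fun n => (s n).1) Filter.atTop (nhds P.1) :=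
    (continuous_fst.tendsto P).comp hlim
  have hcont : Continuous fun Q : L2 Ω × (Fin d → L2 Ω) => ((C : ℝ) + 1) * ∑ k, ‖Q.2 k‖ := by
    fun_prop
  have hlim2 := ((ENNReal.continuous_ofReal.comp hcont).tendsto P).comp hlim
  refine le_of_forall_gt_imp_ge_of_dense fun r hr => ?_
  refine eLpNorm_le_of_tendstoInMeasure ?_ (tendstoInMeasure_of_tendsto_Lp hlim1)
    fun n => Lp.aestronglyMeasurable _
  filter_upwards [hlim2.eventually (gt_mem_nhds hr)] with n hn
  exact (key (s n) (hs n)).trans hn.le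

/-! ### Hölder's inequality for triple products -/

section Hoelder

variable {α : Type*} [MeasurableSpace α] {m : Measure α} {f g h : α → ℝ}

lemma lintegral_enorm_mul_mul_le (hf : AEStronglyMeasurable f m)
    (hg : AEStronglyMeasurable g m) (hh : AEStronglyMeasurable h m) :
    ∫⁻ x, ‖f x * g x * h x‖ₑ ∂m ≤
      eLpNorm f 2 m * eLpNorm g 6 m * (eLpNorm h 6 m * eLpNorm h 2 m) ^ (1 / 2 : ℝ) := by
  have h2 : ∀ φ : α → ℝ, eLpNorm φ 2 m = (∫⁻ x, ‖φ x‖ₑ ^ (2 : ℝ) ∂m) ^ (1 / 2 : ℝ) := fun φ => by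
    rw [eLpNorm_eq_lintegral_rpow_enorm_toReal (by norm_num) (by norm_num)]; norm_num
  have h6 : ∀ φ : α → ℝ, eLpNorm φ 6 m = (∫⁻ x, ‖φ x‖ₑ ^ (6 : ℝ) ∂m) ^ (1 / 6 : ℝ) := fun φ => by
    rw [eLpNorm_eq_lintegral_rpow_enorm_toReal (by norm_num) (by norm_num)]; norm_num
  have key := ENNReal.lintegral_prod_norm_pow_le (μ := m) (Finset.univ : Finset (Fin 4))
    (f := ![fun x => ‖f x‖ₑ ^ (2 : ℝ), fun x => ‖g x‖ₑ ^ (6 : ℝ), fun x => ‖h x‖ₑ ^ (6 : ℝ),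
      fun x => ‖h x‖ₑ ^ (2 : ℝ)]) (p := ![1 / 2, 1 / 6, 1 / 12, 1 / 4])
    (by
      intro i _
      fin_cases i
      · exact hf.enorm.pow_const _
      · exact hg.enorm.pow_const _
      · exact hh.enorm.pow_const _
      · exact hh.enorm.pow_const _)
    (by simp [Fin.sum_univ_four]; norm_num)
    (by intro i _; fin_cases i <;> norm_num)
  simp only [Fin.prod_univ_four, Matrix.cons_val_zero, Matrix.cons_val_one, Matrix.cons_val] at key
  rw [h2 f, h6 g, h6 h, h2 h, ENNReal.mul_rpow_of_nonneg _ _ (by norm_num : (0 : ℝ) ≤ 1 / 2),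
    ← ENNReal.rpow_mul, ← ENNReal.rpow_mul, ← mul_assoc]
  refine le_trans (le_of_eq (lintegral_congr fun x => ?_)) (key.trans (le_of_eq ?_))
  · rw [enorm_mul, enorm_mul, ← ENNReal.rpow_mul, ← ENNReal.rpow_mul, ← ENNReal.rpow_mul,
      ← ENNReal.rpow_mul, mul_assoc (_ * _),
      ← ENNReal.rpow_add_of_nonneg _ _ (by norm_num) (by norm_num)]
    norm_num
  · norm_num

/-- The interpolated Hölder inequality: exponent `2` on `f`, `6` on `g`, and `3` on `h`, the last
norm being interpolated between `6` and `2`. -/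
lemma integrable_and_abs_integral_mul_mul_le (hf : MemLp f 2 m) (hg : MemLp g 6 m)
    (hh : MemLp h 6 m) (hh2 : MemLp h 2 m) :
    Integrable (fun x => f x * g x * h x) m ∧
    |∫ x, f x * g x * h x ∂m| ≤ (eLpNorm f 2 m).toReal * (eLpNorm g 6 m).toReal *
      √((eLpNorm h 6 m).toReal * (eLpNorm h 2 m).toReal) := by
  have hle := lintegral_enorm_mul_mul_le hf.1 hg.1 hh.1
  have htop : eLpNorm f 2 m * eLpNorm g 6 m *
      (eLpNorm h 6 m * eLpNorm h 2 m) ^ (1 / 2 : ℝ) ≠ ⊤ :=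
    ENNReal.mul_ne_top (ENNReal.mul_ne_top hf.2.ne hg.2.ne)
      (ENNReal.rpow_ne_top_of_nonneg (by norm_num) (ENNReal.mul_ne_top hh.2.ne hh2.2.ne))
  have hmeas : AEStronglyMeasurable (fun x => f x * g x * h x) m := (hf.1.mul hg.1).mul hh.1
  refine ⟨⟨hmeas, hle.trans_lt htop.lt_top⟩, ?_⟩
  have h1 : |∫ x, f x * g x * h x ∂m| ≤ (∫⁻ x, ‖f x * g x * h x‖ₑ ∂m).toReal := by
    rw [← integral_norm_eq_lintegral_enorm hmeas]
    exact norm_integral_le_integral_norm (fun x => f x * g x * h x)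
  refine (h1.trans (ENNReal.toReal_mono htop hle)).trans (le_of_eq ?_)
  rw [ENNReal.toReal_mul, ENNReal.toReal_mul, ← ENNReal.toReal_rpow, ENNReal.toReal_mul,
    Real.sqrt_eq_rpow]

end Hoelder

/-- `∫_Ω f g h`. The integral is meaningful when two of the factors are in `L⁶(Ω)`, as the function
parts of elements of `H¹₀(Ω)` are. -/
def tripleInt (f g h : L2 Ω) : ℝ := ∫ x in Ω, f x * g x * h x

/-- `C` is a constant for which the Sobolev inequality `‖P‖_{L⁶} ≤ C ∑_k ‖∂_k P‖` holds on `H¹₀(Ω)`. -/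
def IsSobolevConst (Ω : Set (EuclideanSpace ℝ (Fin d))) (C : ℝ) : Prop :=
  0 < C ∧ ∀ P ∈ H10 Ω,
    eLpNorm P.1 6 (volume.restrict Ω) ≤ ENNReal.ofReal (C * ∑ k, ‖P.2 k‖)

namespace IsSobolevConst

variable {C : ℝ}

lemma memLp_six (hC : IsSobolevConst Ω C) {P : L2 Ω × (Fin d → L2 Ω)} (hP : P ∈ H10 Ω) :
    MemLp P.1 6 (volume.restrict Ω) :=
  ⟨Lp.aestronglyMeasurable _, (hC.2 P hP).trans_lt ENNReal.ofReal_lt_top⟩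

lemma toReal_le (hC : IsSobolevConst Ω C) {P : L2 Ω × (Fin d → L2 Ω)} (hP : P ∈ H10 Ω) :
    (eLpNorm P.1 6 (volume.restrict Ω)).toReal ≤ C * ∑ k, ‖P.2 k‖ :=
  ENNReal.toReal_le_of_le_ofReal
    (mul_nonneg hC.1.le (Finset.sum_nonneg fun _ _ => norm_nonneg _)) (hC.2 P hP)

variable {P Q R : L2 Ω × (Fin d → L2 Ω)}

lemma integrable (hC : IsSobolevConst Ω C) (f : L2 Ω) (hP : P ∈ H10 Ω) (hQ : Q ∈ H10 Ω) :
    Integrable (fun x => f x * P.1 x * Q.1 x) (volume.restrict Ω) :=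
  (integrable_and_abs_integral_mul_mul_le (Lp.memLp f) (hC.memLp_six hP) (hC.memLp_six hQ)
    (Lp.memLp Q.1)).1

lemma abs_tripleInt_le (hC : IsSobolevConst Ω C) (f : L2 Ω) (hP : P ∈ H10 Ω) (hQ : Q ∈ H10 Ω) :
    |tripleInt f P.1 Q.1| ≤
      ‖f‖ * (C * ∑ k, ‖P.2 k‖) * √((C * ∑ k, ‖Q.2 k‖) * ‖Q.1‖) := by
  refine (integrable_and_abs_integral_mul_mul_le (Lp.memLp f) (hC.memLp_six hP)
    (hC.memLp_six hQ) (Lp.memLp Q.1)).2.trans ?_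
  rw [← Lp.norm_def, ← Lp.norm_def]
  have h1 := hC.toReal_le hP
  have h2 := hC.toReal_le hQ
  have h3 : 0 ≤ C * ∑ k, ‖P.2 k‖ := ENNReal.toReal_nonneg.trans h1
  gcongr

end IsSobolevConst

/-! ### Integration by parts and the Poincaré inequality on `H¹₀(Ω)` -/

lemma tripleInt_comm (f g h : L2 Ω) : tripleInt f g h = tripleInt f h g :=
  integral_congr_ae (.of_forall fun x => by ring)

namespace IsSobolevConst

variable {C : ℝ} {P P' Q : L2 Ω × (Fin d → L2 Ω)}

lemma tripleInt_sub_left (hC : IsSobolevConst Ω C) (f f' : L2 Ω) (hP : P ∈ H10 Ω)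
    (hQ : Q ∈ H10 Ω) :
    tripleInt (f - f') P.1 Q.1 = tripleInt f P.1 Q.1 - tripleInt f' P.1 Q.1 := by
  rw [tripleInt, tripleInt, tripleInt, ← integral_sub (hC.integrable f hP hQ)
    (hC.integrable f' hP hQ)]
  refine integral_congr_ae ?_
  filter_upwards [Lp.coeFn_sub f f'] with x hx
  rw [hx, Pi.sub_apply]
  ring

lemma tripleInt_sub_mid (hC : IsSobolevConst Ω C) (f : L2 Ω) (hP : P ∈ H10 Ω)
    (hP' : P' ∈ H10 Ω) (hQ : Q ∈ H10 Ω) :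
    tripleInt f (P - P').1 Q.1 = tripleInt f P.1 Q.1 - tripleInt f P'.1 Q.1 := by
  rw [tripleInt, tripleInt, tripleInt, ← integral_sub (hC.integrable f hP hQ)
    (hC.integrable f hP' hQ)]
  refine integral_congr_ae ?_
  filter_upwards [Lp.coeFn_sub P.1 P'.1] with x hx
  rw [Prod.fst_sub, hx, Pi.sub_apply]
  ring

end IsSobolevConst

lemma sum_norm_snd_le (P : L2 Ω × (Fin d → L2 Ω)) : ∑ k, ‖P.2 k‖ ≤ d * ‖P‖ := by
  calc ∑ k, ‖P.2 k‖ ≤ ∑ _k : Fin d, ‖P‖ :=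
        Finset.sum_le_sum fun k _ => (norm_le_pi_norm P.2 k).trans (norm_snd_le P)
    _ = _ := by simp

/-- The integral `∫_Ω ∂_k (P Q R)`, expanded by the product rule. -/
def leibnizInt (k : Fin d) (P Q R : L2 Ω × (Fin d → L2 Ω)) : ℝ :=
  tripleInt (P.2 k) Q.1 R.1 + tripleInt (Q.2 k) P.1 R.1 + tripleInt (R.2 k) P.1 Q.1

lemma leibnizInt_swap_left (k : Fin d) (P Q R : L2 Ω × (Fin d → L2 Ω)) :
    leibnizInt k P Q R = leibnizInt k Q P R := by
  rw [leibnizInt, leibnizInt, tripleInt_comm (R.2 k) P.1 Q.1]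
  ring

lemma leibnizInt_rotate (k : Fin d) (P Q R : L2 Ω × (Fin d → L2 Ω)) :
    leibnizInt k P Q R = leibnizInt k R P Q := by
  rw [leibnizInt, leibnizInt, tripleInt_comm (P.2 k) Q.1 R.1, tripleInt_comm (Q.2 k) P.1 R.1]
  ring

lemma tripleInt_eq_integral {f g h : L2 Ω} {φ ψ χ : EuclideanSpace ℝ (Fin d) → ℝ}
    (hf : f =ᵐ[volume.restrict Ω] φ) (hg : g =ᵐ[volume.restrict Ω] ψ)
    (hh : h =ᵐ[volume.restrict Ω] χ) (hs : tsupport χ ⊆ Ω) :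
    tripleInt f g h = ∫ x, φ x * ψ x * χ x := by
  rw [tripleInt, ← setIntegral_eq_integral_of_forall_compl_eq_zero (s := Ω)
    (f := fun x => φ x * ψ x * χ x)]
  · refine integral_congr_ae ?_
    filter_upwards [hf, hg, hh] with x h1 h2 h3
    rw [h1, h2, h3]
  · intro x hx
    rw [image_eq_zero_of_notMem_tsupport fun h => hx (hs h), mul_zero]

lemma leibnizInt_eq_zero_of_smooth (k : Fin d) {P Q R : L2 Ω × (Fin d → L2 Ω)}
    (hP : P ∈ testGraph Ω) (hQ : Q ∈ testGraph Ω) (hR : R ∈ testGraph Ω) :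
    leibnizInt k P Q R = 0 := by
  obtain ⟨φ, p1, p2, p3, p4, p5⟩ := hP
  obtain ⟨ψ, q1, q2, q3, q4, q5⟩ := hQ
  obtain ⟨χ, r1, r2, r3, r4, r5⟩ := hR
  set e : EuclideanSpace ℝ (Fin d) := EuclideanSpace.single k 1
  have hφ : Continuous fun x => fderiv ℝ φ x e :=
    (p1.continuous_fderiv (by simp)).clm_apply continuous_const
  have hψ : Continuous fun x => fderiv ℝ ψ x e :=
    (q1.continuous_fderiv (by simp)).clm_apply continuous_const
  have hχ : Continuous fun x => fderiv ℝ χ x e :=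
    (r1.continuous_fderiv (by simp)).clm_apply continuous_const
  have e1 : tripleInt (P.2 k) Q.1 R.1 = ∫ x, fderiv ℝ φ x e * ψ x * χ x :=
    tripleInt_eq_integral (p5 k) q4 r4 r3
  have e2 : tripleInt (Q.2 k) P.1 R.1 = ∫ x, fderiv ℝ ψ x e * φ x * χ x :=
    tripleInt_eq_integral (q5 k) p4 r4 r3
  have e3 : tripleInt (R.2 k) P.1 Q.1 = ∫ x, fderiv ℝ χ x e * φ x * ψ x :=
    tripleInt_eq_integral (r5 k) p4 q4 q3
  have i1 : Integrable fun x => fderiv ℝ φ x e * ψ x * χ x :=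
    ((hφ.mul q1.continuous).mul r1.continuous).integrable_of_hasCompactSupport r2.mul_left
  have i2 : Integrable fun x => fderiv ℝ ψ x e * φ x * χ x :=
    ((hψ.mul p1.continuous).mul r1.continuous).integrable_of_hasCompactSupport r2.mul_left
  have i3 : Integrable fun x => φ x * ψ x * fderiv ℝ χ x e :=
    ((p1.continuous.mul q1.continuous).mul hχ).integrable_of_hasCompactSupport
      (p2.mul_right.mul_right)
  have i0 : Integrable fun x => φ x * ψ x * χ x :=
    ((p1.continuous.mul q1.continuous).mul r1.continuous).integrable_of_hasCompactSupport
      r2.mul_left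
  have hd : ∀ x, fderiv ℝ (fun y => φ y * ψ y) x e * χ x =
      fderiv ℝ φ x e * ψ x * χ x + fderiv ℝ ψ x e * φ x * χ x := fun x => by
    rw [fderiv_fun_mul (p1.differentiable (by simp) x) (q1.differentiable (by simp) x)]
    simp
    ring
  have hparts := integral_mul_fderiv_eq_neg_fderiv_mul_of_integrable
    (μ := (volume : Measure (EuclideanSpace ℝ (Fin d))))
    (f := fun y => φ y * ψ y) (g := χ) (v := e)
    (by simp only [hd]; exact i1.add i2) i3 i0
    (fun x _ => (p1.mul q1).differentiable (by simp) x) (fun x _ => r1.differentiable (by simp) x)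
  rw [leibnizInt, e1, e2, e3, ← integral_add i1 i2]
  simp only [hd] at hparts
  rw [show (∫ x, fderiv ℝ χ x e * φ x * ψ x) = ∫ x, φ x * ψ x * fderiv ℝ χ x e from
    integral_congr_ae (.of_forall fun x => by ring), hparts, add_neg_cancel]

namespace IsSobolevConst

variable {C : ℝ} {P Q R : L2 Ω × (Fin d → L2 Ω)}

lemma exists_abs_leibnizInt_le (hC : IsSobolevConst Ω C) (k : Fin d) (hQ : Q ∈ H10 Ω)
    (hR : R ∈ H10 Ω) : ∃ M : ℝ, ∀ P ∈ H10 Ω, |leibnizInt k P Q R| ≤ M * ‖P‖ := by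
  have hC0 := hC.1.le
  refine ⟨(C * ∑ k, ‖Q.2 k‖) * √((C * ∑ k, ‖R.2 k‖) * ‖R.1‖) +
    ‖Q.2 k‖ * (C * d) * √((C * ∑ k, ‖R.2 k‖) * ‖R.1‖) +
    ‖R.2 k‖ * (C * d) * √((C * ∑ k, ‖Q.2 k‖) * ‖Q.1‖), fun P hP => ?_⟩
  have b1 := hC.abs_tripleInt_le (P.2 k) hQ hR
  have b2 := hC.abs_tripleInt_le (Q.2 k) hP hR
  have b3 := hC.abs_tripleInt_le (R.2 k) hP hQ
  have n1 : ‖P.2 k‖ ≤ ‖P‖ := (norm_le_pi_norm P.2 k).trans (norm_snd_le P)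
  have n2 : C * ∑ k, ‖P.2 k‖ ≤ C * d * ‖P‖ := by
    rw [mul_assoc]
    exact mul_le_mul_of_nonneg_left (sum_norm_snd_le P) hC0
  have c1 : |tripleInt (P.2 k) Q.1 R.1| ≤
      ‖P‖ * (C * ∑ k, ‖Q.2 k‖) * √((C * ∑ k, ‖R.2 k‖) * ‖R.1‖) := by
    refine b1.trans ?_
    have : 0 ≤ C * ∑ k, ‖Q.2 k‖ := by positivity
    gcongr
  have c2 : |tripleInt (Q.2 k) P.1 R.1| ≤
      ‖Q.2 k‖ * (C * d * ‖P‖) * √((C * ∑ k, ‖R.2 k‖) * ‖R.1‖) := b2.trans (by gcongr)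
  have c3 : |tripleInt (R.2 k) P.1 Q.1| ≤
      ‖R.2 k‖ * (C * d * ‖P‖) * √((C * ∑ k, ‖Q.2 k‖) * ‖Q.1‖) := b3.trans (by gcongr)
  refine (abs_add_three _ _ _).trans ?_
  linarith

lemma leibnizInt_eq_zero_of_forall_testGraph (hC : IsSobolevConst Ω C) (k : Fin d)
    (hQ : Q ∈ H10 Ω) (hR : R ∈ H10 Ω) (h : ∀ P ∈ testGraph Ω, leibnizInt k P Q R = 0)
    (hP : P ∈ H10 Ω) : leibnizInt k P Q R = 0 := by
  obtain ⟨M, hM⟩ := hC.exists_abs_leibnizInt_le k hQ hR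
  obtain ⟨s, hs, hlim⟩ := exists_seq_testGraph hP
  have hsub : ∀ n, leibnizInt k (P - s n) Q R = leibnizInt k P Q R := fun n => by
    have hsn : s n ∈ H10 Ω := (testGraph Ω).le_topologicalClosure (hs n)
    have h0 := h (s n) (hs n)
    rw [leibnizInt] at h0
    rw [leibnizInt, leibnizInt, Prod.snd_sub, Pi.sub_apply, hC.tripleInt_sub_left _ _ hQ hR,
      hC.tripleInt_sub_mid _ hP hsn hR, hC.tripleInt_sub_mid _ hP hsn hQ]
    linarith
  have hlim0 : Filter.Tendsto (fun n => M * ‖P - s n‖) Filter.atTop (nhds 0) := by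
    have := (((tendsto_const_nhds (x := P)).sub hlim).norm).const_mul M
    simpa using this
  have hle : |leibnizInt k P Q R| ≤ 0 := ge_of_tendsto' hlim0 fun n => by
    rw [← hsub n]
    exact hM _ (Submodule.sub_mem _ hP ((testGraph Ω).le_topologicalClosure (hs n)))
  exact abs_nonpos_iff.1 hle

/-- Integration by parts for a product of three `H¹₀(Ω)` functions, by density of the test
functions in one factor at a time. -/
lemma leibnizInt_eq_zero (hC : IsSobolevConst Ω C) (k : Fin d) (hP : P ∈ H10 Ω) (hQ : Q ∈ H10 Ω)
    (hR : R ∈ H10 Ω) : leibnizInt k P Q R = 0 := by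
  have hle : ∀ {S}, S ∈ testGraph Ω → S ∈ H10 Ω :=
    fun hS => (testGraph Ω).le_topologicalClosure hS
  refine hC.leibnizInt_eq_zero_of_forall_testGraph k hQ hR (fun P hP => ?_) hP
  rw [leibnizInt_swap_left]
  refine hC.leibnizInt_eq_zero_of_forall_testGraph k (hle hP) hR (fun Q hQ => ?_) hQ
  rw [leibnizInt_rotate]
  refine hC.leibnizInt_eq_zero_of_forall_testGraph k (hle hQ) (hle hP) (fun R hR => ?_) hR
  exact leibnizInt_eq_zero_of_smooth k hR hQ hP

/-- **Poincaré inequality** on `H¹₀(Ω)`. -/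
lemma exists_norm_le (hC : IsSobolevConst Ω C) (hΩb : Bornology.IsBounded Ω) :
    ∃ A : ℝ, 0 ≤ A ∧ ∀ P ∈ H10 Ω, ‖P.1‖ ≤ A * ∑ k, ‖P.2 k‖ := by
  have hfin : (volume.restrict Ω) Set.univ ≠ ⊤ := by
    simpa using hΩb.measure_lt_top.ne
  set t := (volume.restrict Ω) Set.univ ^
    (1 / (2 : ENNReal).toReal - 1 / (6 : ENNReal).toReal)
  have ht : t ≠ ⊤ := ENNReal.rpow_ne_top_of_nonneg (by norm_num) hfin
  refine ⟨C * t.toReal, mul_nonneg hC.1.le ENNReal.toReal_nonneg, fun P hP => ?_⟩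
  have h1 : eLpNorm P.1 2 (volume.restrict Ω) ≤ eLpNorm P.1 6 (volume.restrict Ω) * t :=
    eLpNorm_le_eLpNorm_mul_rpow_measure_univ (by norm_num) (Lp.aestronglyMeasurable _)
  rw [Lp.norm_def]
  calc (eLpNorm P.1 2 (volume.restrict Ω)).toReal
      ≤ (eLpNorm P.1 6 (volume.restrict Ω)).toReal * t.toReal := by
        rw [← ENNReal.toReal_mul]
        exact ENNReal.toReal_mono (ENNReal.mul_ne_top (hC.memLp_six hP).2.ne ht) h1
    _ ≤ (C * ∑ k, ‖P.2 k‖) * t.toReal := by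
        gcongr
        exact hC.toReal_le hP
    _ = _ := by ring

end IsSobolevConst

/-! ### The trilinear form and the dual norm on `X` -/

/-- The velocity `v` as an element of the Hilbert space `L²(Ω)^d`. -/
def l2Map : Velocity Ω →ₗ[ℝ] PiLp 2 (fun _ : Fin d => L2 Ω) where
  toFun v := WithLp.toLp 2 fun i => comp v i
  map_add' _ _ := rfl
  map_smul' _ _ := rfl

/-- The velocity gradient `∇v` as an element of the Hilbert space `L²(Ω)^(d × d)`; the entry at
`(i, k)` is `∂_k v_i`. -/
def gradMap : Velocity Ω →ₗ[ℝ] PiLp 2 (fun _ : Fin d × Fin d => L2 Ω) where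
  toFun v := WithLp.toLp 2 fun q => pder v q.2 q.1
  map_add' _ _ := rfl
  map_smul' _ _ := rfl

lemma l2Inner_eq_inner (u v : Velocity Ω) : l2Inner u v = inner ℝ (l2Map u) (l2Map v) := by
  rw [PiLp.inner_apply]
  rfl

lemma gradInner_eq_inner (u v : Velocity Ω) :
    gradInner u v = inner ℝ (gradMap u) (gradMap v) := by
  rw [PiLp.inner_apply, Fintype.sum_prod_type]
  rfl

lemma l2Norm_eq_norm (v : Velocity Ω) : l2Norm v = ‖l2Map v‖ := by
  rw [l2Norm, l2Inner_eq_inner, norm_eq_sqrt_real_inner]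

lemma gradNorm_eq_norm (v : Velocity Ω) : gradNorm v = ‖gradMap v‖ := by
  rw [gradNorm, gradInner_eq_inner, norm_eq_sqrt_real_inner]

lemma l2Norm_nonneg (v : Velocity Ω) : 0 ≤ l2Norm v := Real.sqrt_nonneg _

lemma gradNorm_nonneg (v : Velocity Ω) : 0 ≤ gradNorm v := Real.sqrt_nonneg _

lemma norm_comp_le (v : Velocity Ω) (i : Fin d) : ‖comp v i‖ ≤ l2Norm v := by
  rw [l2Norm_eq_norm]
  exact PiLp.norm_apply_le (l2Map v) i

lemma norm_pder_le (v : Velocity Ω) (k i : Fin d) : ‖pder v k i‖ ≤ gradNorm v := by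
  rw [gradNorm_eq_norm]
  exact PiLp.norm_apply_le (gradMap v) (i, k)

lemma sum_norm_pder_le (v : Velocity Ω) (i : Fin d) :
    ∑ k, ‖pder v k i‖ ≤ d * gradNorm v := by
  calc ∑ k, ‖pder v k i‖ ≤ ∑ _k : Fin d, gradNorm v :=
        Finset.sum_le_sum fun k _ => norm_pder_le v k i
    _ = _ := by simp

namespace IsSobolevConst

variable {C : ℝ}

lemma convection_eq_sum (hC : IsSobolevConst Ω C) (u v w : Velocity Ω) :
    convection u v w = ∑ i, ∑ k, tripleInt (pder v k i) (comp u k) (comp w i) := by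
  have hint : ∀ i k, Integrable (fun x => comp u k x * pder v k i x * comp w i x)
      (volume.restrict Ω) := fun i k => by
    refine (hC.integrable (pder v k i) (u k).2 (w i).2).congr (.of_forall fun x => ?_)
    simp only [comp]
    ring
  rw [convection, integral_finsetSum _ fun i _ => integrable_finsetSum _ fun k _ => hint i k]
  refine Finset.sum_congr rfl fun i _ => ?_
  rw [integral_finsetSum _ fun k _ => hint i k]
  exact Finset.sum_congr rfl fun k _ => integral_congr_ae (.of_forall fun x => by ring)

lemma bStar_sub_left_self (hC : IsSobolevConst Ω C) (u v w : Velocity Ω) :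
    bStar u (v - w) v = bStar u v w := by
  have h1 : convection u (v - w) v = convection u v v - convection u w v := by
    simp only [hC.convection_eq_sum, ← Finset.sum_sub_distrib]
    exact Finset.sum_congr rfl fun i _ => Finset.sum_congr rfl fun k _ =>
      hC.tripleInt_sub_left _ _ (u k).2 (v i).2
  have h2 : convection u v (v - w) = convection u v v - convection u v w := by
    simp only [hC.convection_eq_sum, ← Finset.sum_sub_distrib]
    refine Finset.sum_congr rfl fun i _ => Finset.sum_congr rfl fun k _ => ?_
    rw [tripleInt_comm, tripleInt_comm _ _ (comp v i), tripleInt_comm _ _ (comp w i)]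
    exact hC.tripleInt_sub_mid _ (v i).2 (w i).2 (u k).2
  rw [bStar, bStar, h1, h2]
  ring

/-- Moving the derivative off the third argument by parts, at the cost of a divergence term. -/
lemma bStar_eq_sum (hC : IsSobolevConst Ω C) (u v w : Velocity Ω) :
    bStar u v w = ∑ i, ∑ k, (tripleInt (pder v k i) (comp u k) (comp w i) +
      1 / 2 * tripleInt (pder u k k) (comp v i) (comp w i)) := by
  rw [bStar, hC.convection_eq_sum, hC.convection_eq_sum, Finset.mul_sum, Finset.mul_sum,
    ← Finset.sum_sub_distrib]
  refine Finset.sum_congr rfl fun i _ => ?_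
  rw [Finset.mul_sum, Finset.mul_sum, ← Finset.sum_sub_distrib]
  refine Finset.sum_congr rfl fun k _ => ?_
  have h := hC.leibnizInt_eq_zero k (u k).2 (v i).2 (w i).2
  rw [leibnizInt] at h
  change tripleInt (pder u k k) (comp v i) (comp w i) +
    tripleInt (pder v k i) (comp u k) (comp w i) +
    tripleInt (pder w k i) (comp u k) (comp v i) = 0 at h
  linarith

lemma abs_tripleInt_pder_le (hC : IsSobolevConst Ω C) (u v w : Velocity Ω) (k i j l : Fin d) :
    |tripleInt (pder u k i) (comp v j) (comp w l)| ≤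
      gradNorm u * (C * (d * gradNorm v)) * √((C * (d * gradNorm w)) * l2Norm w) := by
  have hC0 := hC.1.le
  have hu := gradNorm_nonneg u
  have hv := gradNorm_nonneg v
  have hw := gradNorm_nonneg w
  refine (hC.abs_tripleInt_le (pder u k i) (v j).2 (w l).2).trans ?_
  have h1 := norm_pder_le u k i
  have h2 : ∑ k, ‖(v j).1.2 k‖ ≤ d * gradNorm v := sum_norm_pder_le v j
  have h3 : ∑ k, ‖(w l).1.2 k‖ ≤ d * gradNorm w := sum_norm_pder_le w l
  have h4 : ‖(w l).1.1‖ ≤ l2Norm w := norm_comp_le w l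
  gcongr

/-- `|b*(u, v, w)| ≤ M ‖∇u‖ ‖∇v‖ ‖∇w‖^{1/2} ‖w‖^{1/2}`. -/
lemma exists_abs_bStar_le (hC : IsSobolevConst Ω C) : ∃ M : ℝ, 0 < M ∧ ∀ u v w : Velocity Ω,
    |bStar u v w| ≤ M * (gradNorm u * gradNorm v) * √(gradNorm w * l2Norm w) := by
  have hC0 := hC.1.le
  refine ⟨d * d * (3 / 2 * (C * d * √(C * d))) + 1, by positivity, fun u v w => ?_⟩
  have hu := gradNorm_nonneg u
  have hv := gradNorm_nonneg v
  have hsq : √((C * (d * gradNorm w)) * l2Norm w) = √(C * d) * √(gradNorm w * l2Norm w) := by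
    rw [← Real.sqrt_mul (by positivity)]
    congr 1
    ring
  have hterm : ∀ i k, |tripleInt (pder v k i) (comp u k) (comp w i) +
      1 / 2 * tripleInt (pder u k k) (comp v i) (comp w i)| ≤
      3 / 2 * (C * d * √(C * d)) * (gradNorm u * gradNorm v) * √(gradNorm w * l2Norm w) := by
    intro i k
    have h1 := hC.abs_tripleInt_pder_le v u w k i k i
    have h2 := hC.abs_tripleInt_pder_le u v w k k i i
    rw [hsq] at h1 h2
    refine (abs_add_le _ _).trans ?_
    rw [abs_mul, abs_of_pos (by norm_num : (0 : ℝ) < 1 / 2)]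
    linarith
  rw [hC.bStar_eq_sum]
  calc _ ≤ ∑ _i : Fin d, ∑ _k : Fin d,
        3 / 2 * (C * d * √(C * d)) * (gradNorm u * gradNorm v) * √(gradNorm w * l2Norm w) :=
        (Finset.abs_sum_le_sum_abs _ _).trans <| Finset.sum_le_sum fun i _ =>
          (Finset.abs_sum_le_sum_abs _ _).trans <| Finset.sum_le_sum fun k _ => hterm i k
    _ = d * d * (3 / 2 * (C * d * √(C * d))) * (gradNorm u * gradNorm v) *
        √(gradNorm w * l2Norm w) := by
        simp
        ring
    _ ≤ _ := by
        gcongr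
        linarith

/-- Poincaré's inequality for the norm of `X`: `‖∇·‖` is an equivalent norm. -/
lemma exists_norm_velocity_le (hC : IsSobolevConst Ω C) (hΩb : Bornology.IsBounded Ω) :
    ∃ A : ℝ, 0 ≤ A ∧ ∀ v : Velocity Ω, ‖v‖ ≤ A * gradNorm v := by
  obtain ⟨A, hA, hAP⟩ := hC.exists_norm_le hΩb
  refine ⟨A * d + 1, by positivity, fun v => ?_⟩
  have hv := gradNorm_nonneg v
  refine (pi_norm_le_iff_of_nonneg (by positivity)).2 fun i => ?_
  have h1 : ‖(v i).1.1‖ ≤ A * (d * gradNorm v) :=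
    (hAP _ (v i).2).trans (mul_le_mul_of_nonneg_left (sum_norm_pder_le v i) hA)
  have h2 : ‖(v i).1.2‖ ≤ gradNorm v :=
    (pi_norm_le_iff_of_nonneg hv).2 fun k => norm_pder_le v k i
  refine norm_prod_le_iff.2 ⟨?_, ?_⟩
  · exact h1.trans (by linarith)
  · exact h2.trans (by nlinarith [mul_nonneg (mul_nonneg hA (Nat.cast_nonneg (α := ℝ) d)) hv])

/-- The supremum defining `‖F‖₋₁` is over a bounded set, by Poincaré's inequality, so that it
bounds `F`. -/
lemma apply_le_dualNorm_mul (hC : IsSobolevConst Ω C) (hΩb : Bornology.IsBounded Ω)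
    (F : Velocity Ω →L[ℝ] ℝ) (v : Velocity Ω) : F v ≤ dualNorm F * gradNorm v := by
  obtain ⟨A, hA, hAv⟩ := hC.exists_norm_velocity_le hΩb
  have hpos : ∀ w : Velocity Ω, w ≠ 0 → 0 < gradNorm w := fun w hw => by
    refine (gradNorm_nonneg w).lt_of_ne' fun h0 => hw ?_
    have := hAv w
    rw [h0, mul_zero] at this
    exact norm_le_zero_iff.1 this
  rcases eq_or_ne v 0 with rfl | hv
  · rw [map_zero, gradNorm_eq_norm, map_zero, norm_zero, mul_zero]
  · rw [← div_le_iff₀ (hpos v hv)]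
    refine le_csSup ⟨‖F‖ * A, ?_⟩ ⟨v, hv, rfl⟩
    rintro r ⟨w, hw, rfl⟩
    rw [div_le_iff₀ (hpos w hw), mul_assoc]
    exact (le_abs_self _).trans ((F.le_opNorm w).trans
      (mul_le_mul_of_nonneg_left (hAv w) (norm_nonneg F)))

end IsSobolevConst

/-! ### The arithmetic of one time step -/

/-- The BDF2 energy identity. -/
lemma bdf2_identity {H : Type*} [NormedAddCommGroup H] [InnerProductSpace ℝ H] (a b c : H) :
    2 * inner ℝ ((3 : ℝ) • a - (4 : ℝ) • b + c) a =
      (‖a‖ ^ 2 + ‖(2 : ℝ) • a - b‖ ^ 2) - (‖b‖ ^ 2 + ‖(2 : ℝ) • b - c‖ ^ 2)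
        + ‖a - (2 : ℝ) • b + c‖ ^ 2 := by
  simp only [← real_inner_self_eq_norm_sq, inner_add_left, inner_add_right, inner_sub_left,
    inner_sub_right, real_inner_smul_left, real_inner_smul_right, real_inner_comm a b,
    real_inner_comm a c, real_inner_comm b c]
  ring

/-- The coefficient `K` of `ν̄ Δt ‖∇u^n‖²` in the discrete energy, with `s = √μ` and
`θ = |ν_j - ν̄| / ν̄`. -/
def dissipationCoeff (s ε θ : ℝ) : ℝ :=
  (s + ε) / (2 - s) * (s / 2 * ((2 + ε) / (s + ε)) - 3 * θ / 2)

/-- In particular `K ≥ 3 θ / 2`, which is what the telescoping needs. -/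
lemma half_le_dissipationCoeff {s ε θ : ℝ} (hs : 0 ≤ s) (hs1 : s < 1) (hε : 0 < ε)
    (hθ : θ ≤ s / 3) : s / 2 ≤ dissipationCoeff s ε θ := by
  have h1 : (0 : ℝ) < 2 - s := by linarith
  have h2 : (0 : ℝ) < s + ε := by linarith
  have h3 : dissipationCoeff s ε θ = (s * (2 + ε) / 2 - 3 * θ / 2 * (s + ε)) / (2 - s) := by
    rw [dissipationCoeff]
    field_simp
  rw [h3, le_div_iff₀ h1]
  nlinarith [mul_le_mul_of_nonneg_right hθ h2.le]

/-- The dissipation `1` pays for `K`, for the convection (`β`), for the viscosity fluctuation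
(`3 θ / 2`) and for the force. -/
lemma dissipationCoeff_add_le {s ε θ β : ℝ} (hs : 0 ≤ s) (hs1 : s < 1) (hε : 0 < ε)
    (hε2 : ε ≤ 2 - 2 * s) (hθ : θ ≤ s / 3) (hβ : β ≤ (2 - 2 * s - ε) * s / (2 * (s + ε))) :
    dissipationCoeff s ε θ + β + 3 * θ / 2 + ε * (2 - s) / (2 * (s + ε)) ≤ 1 := by
  have h1 : (0 : ℝ) < 2 - s := by linarith
  have h2 : (0 : ℝ) < s + ε := by linarith
  have hK := half_le_dissipationCoeff hs hs1 hε hθ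
  -- `K` is `(s + ε) / (2 - s)` times `G`, where `G` is what the forcing and the viscosity
  -- fluctuation leave of the dissipation; `G - K = K (2 - 2 s - ε) / (s + ε)`.
  have hG : 1 - 3 * θ / 2 - ε * (2 - s) / (2 * (s + ε)) - dissipationCoeff s ε θ =
      dissipationCoeff s ε θ * ((2 - 2 * s - ε) / (s + ε)) := by
    rw [dissipationCoeff]
    field_simp
    ring
  have h3 : (2 - 2 * s - ε) * s / (2 * (s + ε)) = s / 2 * ((2 - 2 * s - ε) / (s + ε)) := by
    field_simp
  have h4 : s / 2 * ((2 - 2 * s - ε) / (s + ε)) ≤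
      dissipationCoeff s ε θ * ((2 - 2 * s - ε) / (s + ε)) :=
    mul_le_mul_of_nonneg_right hK (div_nonneg (by linarith) h2.le)
  linarith

/-- One time step of the energy estimate, in terms of the norms involved: `E'`, `E` are
`‖u^n‖² + ‖2u^n - u^{n-1}‖²` at the new and the old level, `D = ‖u^{n+1} - 2u^n + u^{n-1}‖`, `B₂`, `B₁`, `B₀` the
gradient norms of `u^{n+1}`, `u^n`, `u^{n-1}`, and `V`, `L`, `b` the terms of viscosity
fluctuation, force and convection. -/
lemma energy_step {E' E D B₂ B₁ B₀ F nb Δt s ε θ κ V L b : ℝ} (hnb : 0 < nb) (hΔt : 0 < Δt)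
    (hs : 0 ≤ s) (hs1 : s < 1) (hε : 0 < ε) (hε2 : ε ≤ 2 - 2 * s) (hθ0 : 0 ≤ θ) (hθ : θ ≤ s / 3)
    (hκ : 2 * κ ^ 2 * (Δt / nb) ≤ (2 - 2 * s - ε) * s / (2 * (s + ε)))
    (hV : -V ≤ nb * θ * ((2 * B₁ + B₀) * B₂)) (hL : L ≤ F * B₂) (hb : b ≤ κ * B₂ * D)
    (hE : (E' - E + D ^ 2) / (4 * Δt) + nb * B₂ ^ 2 + V = L + b) :
    1 / 4 * E' + 1 / 8 * D ^ 2 + nb * Δt * dissipationCoeff s ε θ * B₂ ^ 2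
        + nb * Δt * (θ / 2) * B₁ ^ 2 ≤
      (s + ε) / (2 * ε * (2 - s)) * (Δt / nb) * F ^ 2
        + (1 / 4 * E + nb * Δt * dissipationCoeff s ε θ * B₁ ^ 2
          + nb * Δt * (θ / 2) * B₀ ^ 2) := by
  have h1 : (0 : ℝ) < 2 - s := by linarith
  have h2 : (0 : ℝ) < s + ε := by linarith
  have hK := half_le_dissipationCoeff hs hs1 hε hθ
  have hK2 := dissipationCoeff_add_le hs hs1 hε hε2 hθ hκ
  set K := dissipationCoeff s ε θ
  have hνt : 0 < nb * Δt := mul_pos hnb hΔt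
  have hE1 : 1 / 4 * (E' - E) + 1 / 4 * D ^ 2 + Δt * (nb * B₂ ^ 2) = Δt * (L + b - V) := by
    rw [← hE]
    field_simp
    ring
  have hV1 : Δt * -V ≤ nb * Δt * θ * (3 / 2 * B₂ ^ 2 + B₁ ^ 2 + B₀ ^ 2 / 2) := by
    have : (2 * B₁ + B₀) * B₂ ≤ 3 / 2 * B₂ ^ 2 + B₁ ^ 2 + B₀ ^ 2 / 2 := by
      nlinarith [sq_nonneg (B₁ - B₂), sq_nonneg (B₀ - B₂)]
    calc Δt * -V ≤ Δt * (nb * θ * ((2 * B₁ + B₀) * B₂)) := by gcongr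
      _ ≤ Δt * (nb * θ * (3 / 2 * B₂ ^ 2 + B₁ ^ 2 + B₀ ^ 2 / 2)) := by gcongr
      _ = _ := by ring
  have hL1 : Δt * L ≤ (s + ε) / (2 * ε * (2 - s)) * (Δt / nb) * F ^ 2 +
      nb * Δt * (ε * (2 - s) / (2 * (s + ε))) * B₂ ^ 2 := by
    have hsq : (s + ε) / (2 * ε * (2 - s)) * (Δt / nb) * F ^ 2 +
        nb * Δt * (ε * (2 - s) / (2 * (s + ε))) * B₂ ^ 2 - Δt * (F * B₂) =
        Δt / (2 * ε * (2 - s) * (s + ε) * nb) *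
          ((s + ε) * F - nb * (ε * (2 - s)) * B₂) ^ 2 := by
      field_simp
      ring
    have : 0 ≤ Δt / (2 * ε * (2 - s) * (s + ε) * nb) *
          ((s + ε) * F - nb * (ε * (2 - s)) * B₂) ^ 2 := by positivity
    have := mul_le_mul_of_nonneg_left hL hΔt.le
    linarith
  have hb1 : Δt * b ≤ 1 / 8 * D ^ 2 + nb * Δt * (2 * κ ^ 2 * (Δt / nb)) * B₂ ^ 2 := by
    have : nb * Δt * (2 * κ ^ 2 * (Δt / nb)) = 2 * κ ^ 2 * Δt ^ 2 := by field_simp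
    rw [this]
    have := mul_le_mul_of_nonneg_left hb hΔt.le
    nlinarith [sq_nonneg (D - 4 * (Δt * κ * B₂))]
  have hB2 := mul_le_mul_of_nonneg_left hK2 (mul_nonneg hνt.le (sq_nonneg B₂))
  have hB1 : nb * Δt * B₁ ^ 2 * (3 * θ / 2) ≤ nb * Δt * B₁ ^ 2 * K :=
    mul_le_mul_of_nonneg_left (by linarith) (by positivity)
  linarith

/-! ### The energy estimate for the scheme -/

lemma nuBar_pos {J : ℕ} {ν : Fin J → ℝ} (hν : ∀ j, 0 < ν j) (j : Fin J) : 0 < nuBar ν := by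
  have hJ : (0 : ℝ) < J := by exact_mod_cast j.pos
  exact mul_pos (by positivity) (Finset.sum_pos (fun i _ => hν i) ⟨j, Finset.mem_univ j⟩)

lemma l2Inner_bdf2 {Δt : ℝ} (a b c : Velocity Ω) :
    l2Inner ((1 / (2 * Δt)) • ((3 : ℝ) • a - (4 : ℝ) • b + c)) a =
      ((l2Norm a ^ 2 + l2Norm ((2 : ℝ) • a - b) ^ 2)
        - (l2Norm b ^ 2 + l2Norm ((2 : ℝ) • b - c) ^ 2)
        + l2Norm (a - (2 : ℝ) • b + c) ^ 2) / (4 * Δt) := by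
  simp only [l2Inner_eq_inner, l2Norm_eq_norm, map_smul, map_sub, map_add, real_inner_smul_left]
  rw [← bdf2_identity]
  ring

lemma neg_mul_gradInner_le (c : ℝ) (a b u : Velocity Ω) :
    -(c * gradInner ((2 : ℝ) • a - b) u) ≤
      |c| * ((2 * gradNorm a + gradNorm b) * gradNorm u) := by
  refine (neg_le_abs _).trans ?_
  rw [abs_mul]
  gcongr
  simp only [gradInner_eq_inner, gradNorm_eq_norm, map_sub, map_smul]
  refine (abs_real_inner_le_norm _ _).trans ?_
  gcongr
  refine (norm_sub_le _ _).trans ?_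
  rw [norm_smul, Real.norm_ofNat]

/-- One step of the scheme, tested with `u_j^{n+1}` itself: the pressure and the convection by the
ensemble mean drop out, and the fluctuation term carries the second difference in place of the
extrapolated velocity. -/
lemma IsSchemeSolution.energy_identity {C : ℝ} (hC : IsSobolevConst Ω C) {J : ℕ}
    {Xh : Submodule ℝ (Velocity Ω)} {Qh : Submodule ℝ (L2 Ω)} {ν : Fin J → ℝ} {Δt : ℝ}
    {f : Fin J → ℕ → (Velocity Ω →L[ℝ] ℝ)} {N : ℕ} {u : Fin J → ℕ → Velocity Ω}
    {p : Fin J → ℕ → L2 Ω} (hu : IsSchemeSolution Xh Qh ν Δt f N u p) (j : Fin J) {n : ℕ}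
    (hn : 1 ≤ n) (hnN : n + 1 ≤ N) :
    ((l2Norm (u j (n + 1)) ^ 2 + l2Norm ((2 : ℝ) • u j (n + 1) - u j n) ^ 2)
        - (l2Norm (u j n) ^ 2 + l2Norm ((2 : ℝ) • u j n - u j (n - 1)) ^ 2)
        + l2Norm (u j (n + 1) - (2 : ℝ) • u j n + u j (n - 1)) ^ 2) / (4 * Δt)
      + nuBar ν * gradNorm (u j (n + 1)) ^ 2
      + (ν j - nuBar ν) * gradInner ((2 : ℝ) • u j n - u j (n - 1)) (u j (n + 1))
      = f j (n + 1) (u j (n + 1))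
        + -bStar (uFluct u j n) (u j (n + 1)) (u j (n + 1) - (2 : ℝ) • u j n + u j (n - 1)) := by
  have h := hu.momentum j n hn hnN _ (hu.velocity_mem j (n + 1) hnN)
  have hdiv := hu.incompressible j n hn hnN _ (hu.pressure_mem j (n + 1) (by lia) hnN)
  have hskew : bStar (uBar u n) (u j (n + 1)) (u j (n + 1)) = 0 := by
    rw [bStar, sub_self]
  have hext : extrap u j n =
      u j (n + 1) - (u j (n + 1) - (2 : ℝ) • u j n + u j (n - 1)) := by
    rw [extrap]
    abel
  have hfluct : bStar (uFluct u j n) (extrap u j n) (u j (n + 1)) =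
      bStar (uFluct u j n) (u j (n + 1))
        (u j (n + 1) - (2 : ℝ) • u j n + u j (n - 1)) := by
    rw [hext, hC.bStar_sub_left_self]
  have hgrad : gradInner (u j (n + 1)) (u j (n + 1)) = gradNorm (u j (n + 1)) ^ 2 := by
    rw [gradInner_eq_inner, gradNorm_eq_norm, real_inner_self_eq_norm_sq]
  have hbdf := l2Inner_bdf2 (Δt := Δt) (u j (n + 1)) (u j n) (u j (n - 1))
  change l2Inner _ _ + _ + _ - _ + _ + (ν j - nuBar ν) *
    gradInner ((2 : ℝ) • u j n - u j (n - 1)) (u j (n + 1)) = _ at h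
  linear_combination h - hbdf - hskew - hfluct + hdiv - nuBar ν * hgrad

/-- The discrete energy `¼ (‖v^n‖² + ‖2v^n - v^{n-1}‖²) + a (K ‖∇v^n‖² + ½ θ ‖∇v^{n-1}‖²)` of a
sequence of velocities; it is used with `a = ν̄ Δt`. Meaningful for `n ≥ 1`, because of the truncated
`n - 1`. -/
def discreteEnergy (v : ℕ → Velocity Ω) (a K θ : ℝ) (n : ℕ) : ℝ :=
  1 / 4 * (l2Norm (v n) ^ 2 + l2Norm ((2 : ℝ) • v n - v (n - 1)) ^ 2)
    + a * K * gradNorm (v n) ^ 2 + a * (θ / 2) * gradNorm (v (n - 1)) ^ 2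

lemma IsSchemeSolution.discreteEnergy_succ_le {C M : ℝ} (hC : IsSobolevConst Ω C)
    (hΩb : Bornology.IsBounded Ω) (hM : 0 < M)
    (hb : ∀ u v w : Velocity Ω,
      |bStar u v w| ≤ M * (gradNorm u * gradNorm v) * √(gradNorm w * l2Norm w))
    {J : ℕ} {Xh : Submodule ℝ (Velocity Ω)} {Qh : Submodule ℝ (L2 Ω)} {ν : Fin J → ℝ} {Δt : ℝ}
    {f : Fin J → ℕ → (Velocity Ω →L[ℝ] ℝ)} {N : ℕ} {u : Fin J → ℕ → Velocity Ω}
    {p : Fin J → ℕ → L2 Ω} (hu : IsSchemeSolution Xh Qh ν Δt f N u p) (j : Fin J)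
    {h Cinv s ε θ : ℝ} (hh : 0 < h) (hCinv : 0 < Cinv)
    (hinv : ∀ v ∈ Xh, h * gradNorm v ≤ Cinv * l2Norm v) (hnb : 0 < nuBar ν) (hΔt : 0 < Δt)
    (hs : 0 ≤ s) (hs1 : s < 1) (hε : 0 < ε) (hε2 : ε ≤ 2 - 2 * s) (hθ0 : 0 ≤ θ) (hθ : θ ≤ s / 3)
    (hνθ : |ν j - nuBar ν| = nuBar ν * θ) {n : ℕ} (hn : 1 ≤ n) (hnN : n + 1 ≤ N)
    (hcfl : 2 * M ^ 2 * Cinv * (Δt / (nuBar ν * h)) * gradNorm (uFluct u j n) ^ 2 ≤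
      (2 - 2 * s - ε) * s / (2 * (s + ε))) :
    discreteEnergy (u j) (nuBar ν * Δt) (dissipationCoeff s ε θ) θ (n + 1)
        + 1 / 8 * l2Norm (u j (n + 1) - (2 : ℝ) • u j n + u j (n - 1)) ^ 2 ≤
      (s + ε) / (2 * ε * (2 - s)) * (Δt / nuBar ν) * dualNorm (f j (n + 1)) ^ 2
        + discreteEnergy (u j) (nuBar ν * Δt) (dissipationCoeff s ε θ) θ n := by
  have hid := hu.energy_identity hC j hn hnN
  have hwX : u j (n + 1) - (2 : ℝ) • u j n + u j (n - 1) ∈ Xh :=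
    Xh.add_mem (Xh.sub_mem (hu.velocity_mem j _ hnN)
      (Xh.smul_mem _ (hu.velocity_mem j n (by lia)))) (hu.velocity_mem j _ (by lia))
  have hV := neg_mul_gradInner_le (ν j - nuBar ν) (u j n) (u j (n - 1)) (u j (n + 1))
  rw [hνθ] at hV
  generalize u j (n + 1) - (2 : ℝ) • u j n + u j (n - 1) = w at hid hwX ⊢
  have hw0 := l2Norm_nonneg w
  have hwinv : gradNorm w ≤ Cinv / h * l2Norm w := by
    rw [div_mul_eq_mul_div, le_div_iff₀ hh, mul_comm]
    exact hinv w hwX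
  have hsqrt : √(gradNorm w * l2Norm w) ≤ √(Cinv / h) * l2Norm w := by
    calc √(gradNorm w * l2Norm w) ≤ √(Cinv / h * l2Norm w ^ 2) :=
          Real.sqrt_le_sqrt (by nlinarith)
      _ = √(Cinv / h) * l2Norm w := by
          rw [Real.sqrt_mul (by positivity), Real.sqrt_sq hw0]
  -- Young's inequality absorbs the bound `κ ‖∇u^{n+1}‖ ‖w‖` on the convection term into `‖w‖² / 8`,
  -- where `κ = M (Cinv / h)^{1/2} ‖∇u'‖`.
  have hκ : 2 * (M * gradNorm (uFluct u j n) * √(Cinv / h)) ^ 2 * (Δt / nuBar ν) ≤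
      (2 - 2 * s - ε) * s / (2 * (s + ε)) := by
    refine le_trans (le_of_eq ?_) hcfl
    rw [mul_pow, mul_pow, Real.sq_sqrt (by positivity)]
    field_simp
  have hconv : -bStar (uFluct u j n) (u j (n + 1)) w ≤
      M * gradNorm (uFluct u j n) * √(Cinv / h) * gradNorm (u j (n + 1)) * l2Norm w := by
    have h1 := gradNorm_nonneg (uFluct u j n)
    have h2 := gradNorm_nonneg (u j (n + 1))
    calc _ ≤ M * (gradNorm (uFluct u j n) * gradNorm (u j (n + 1))) *
          √(gradNorm w * l2Norm w) := (neg_le_abs _).trans (hb _ _ w)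
      _ ≤ M * (gradNorm (uFluct u j n) * gradNorm (u j (n + 1))) *
          (√(Cinv / h) * l2Norm w) := by gcongr
      _ = _ := by ring
  have key := energy_step hnb hΔt hs hs1 hε hε2 hθ0 hθ hκ hV
    (hC.apply_le_dualNorm_mul hΩb (f j (n + 1)) (u j (n + 1))) hconv hid
  simp only [discreteEnergy, Nat.add_sub_cancel]
  linarith

lemma add_sum_le_of_succ_le {Φ D F : ℕ → ℝ} {N : ℕ}
    (h : ∀ n, 1 ≤ n → n + 1 ≤ N → Φ (n + 1) + D n ≤ F n + Φ n) {m : ℕ} (hm : 1 ≤ m)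
    (hmN : m ≤ N) :
    Φ m + ∑ n ∈ Finset.Icc 1 (m - 1), D n ≤ ∑ n ∈ Finset.Icc 1 (m - 1), F n + Φ 1 := by
  induction m, hm using Nat.le_induction with
  | base => simp
  | succ m hm ih =>
    have h1 := ih (by lia)
    have h2 := h m hm hmN
    obtain ⟨k, rfl⟩ : ∃ k, m = k + 1 := ⟨m - 1, by lia⟩
    simp only [Nat.add_sub_cancel] at h1 ⊢
    rw [Finset.sum_Icc_succ_top (by lia), Finset.sum_Icc_succ_top (by lia)]
    linarith

end EnsembleNS

end

theorem theorem1 {d : ℕ} (hd : d = 2 ∨ d = 3)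
    (Ω : Set (EuclideanSpace ℝ (Fin d))) (hΩ : IsOpen Ω) (hΩb : Bornology.IsBounded Ω)
    (Cinv : ℝ) (hCinv : 0 < Cinv) :
    ∃ C : ℝ, 0 < C ∧
      ∀ (h : ℝ) (Xh : Submodule ℝ (EnsembleNS.Velocity Ω))
        (Qh : Submodule ℝ (EnsembleNS.L2 Ω)),
        0 < h →
        (∀ q ∈ Qh, ∫ x in Ω, q x = 0) →
        (∀ v ∈ Xh, h * EnsembleNS.gradNorm v ≤ Cinv * EnsembleNS.l2Norm v) →
      ∀ (J : ℕ) (ν : Fin J → ℝ) (Δt : ℝ) (f : Fin J → ℕ → (EnsembleNS.Velocity Ω →L[ℝ] ℝ))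
        (N : ℕ) (u : Fin J → ℕ → EnsembleNS.Velocity Ω) (p : Fin J → ℕ → EnsembleNS.L2 Ω),
        (∀ j, 0 < ν j) → 0 < Δt → 2 ≤ N →
        EnsembleNS.IsSchemeSolution Xh Qh ν Δt f N u p →
      ∀ (j : Fin J) (μ ε : ℝ), 0 ≤ μ → μ < 1 → 0 < ε → ε ≤ 2 - 2 * √μ →
        (∀ n, 1 ≤ n → n + 1 ≤ N →
          C * (Δt / (EnsembleNS.nuBar ν * h)) * EnsembleNS.gradNorm (EnsembleNS.uFluct u j n) ^ 2
            ≤ (2 - 2 * √μ - ε) * √μ / (2 * (√μ + ε))) →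
        |ν j - EnsembleNS.nuBar ν| / EnsembleNS.nuBar ν ≤ √μ / 3 →
        1 / 4 * (EnsembleNS.l2Norm (u j N) ^ 2
              + EnsembleNS.l2Norm ((2 : ℝ) • u j N - u j (N - 1)) ^ 2)
          + 1 / 8 * ∑ n ∈ Finset.Icc 1 (N - 1),
              EnsembleNS.l2Norm (u j (n + 1) - (2 : ℝ) • u j n + u j (n - 1)) ^ 2
          + EnsembleNS.nuBar ν * Δt * ((√μ + ε) / (2 - √μ))
              * (√μ / 2 * ((2 + ε) / (√μ + ε))
                  - 3 * |ν j - EnsembleNS.nuBar ν| / (2 * EnsembleNS.nuBar ν))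
              * EnsembleNS.gradNorm (u j N) ^ 2
        ≤ ∑ n ∈ Finset.Icc 1 (N - 1),
              (√μ + ε) / (2 * ε * (2 - √μ)) * (Δt / EnsembleNS.nuBar ν)
                * EnsembleNS.dualNorm (f j (n + 1)) ^ 2
          + 1 / 4 * (EnsembleNS.l2Norm (u j 1) ^ 2
              + EnsembleNS.l2Norm ((2 : ℝ) • u j 1 - u j 0) ^ 2)
          + EnsembleNS.nuBar ν * Δt * ((√μ + ε) / (2 - √μ))
              * (√μ / 2 * ((2 + ε) / (√μ + ε))
                  - 3 * |ν j - EnsembleNS.nuBar ν| / (2 * EnsembleNS.nuBar ν))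
              * EnsembleNS.gradNorm (u j 1) ^ 2
          + Δt * |ν j - EnsembleNS.nuBar ν| / 2 * EnsembleNS.gradNorm (u j 0) ^ 2 := by
  obtain ⟨CS, hCS⟩ : ∃ CS, EnsembleNS.IsSobolevConst Ω CS :=
    EnsembleNS.exists_eLpNorm_six_le hd hΩb
  obtain ⟨M, hM, hb⟩ := hCS.exists_abs_bStar_le
  refine ⟨2 * M ^ 2 * Cinv, by positivity, ?_⟩
  intro h Xh Qh hh _ hinv J ν Δt f N u p hν hΔt hN hu j μ ε _ hμ1 hε hε2 hcfl hθ
  have hnb := EnsembleNS.nuBar_pos hν j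
  have hs : 0 ≤ √μ := Real.sqrt_nonneg μ
  have hs1 : √μ < 1 := by
    rw [Real.sqrt_lt' one_pos]
    linarith
  obtain ⟨θ, hθdef⟩ : ∃ θ, θ = |ν j - EnsembleNS.nuBar ν| / EnsembleNS.nuBar ν := ⟨_, rfl⟩
  have hθ0 : 0 ≤ θ := hθdef ▸ div_nonneg (abs_nonneg _) hnb.le
  have hνθ : |ν j - EnsembleNS.nuBar ν| = EnsembleNS.nuBar ν * θ := by
    rw [hθdef, mul_div_cancel₀ _ hnb.ne']
  rw [← hθdef] at hθ
  have hsum := EnsembleNS.add_sum_le_of_succ_le (fun n hn hnN =>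
    hu.discreteEnergy_succ_le hCS hΩb hM hb j hh hCinv hinv hnb hΔt hs hs1 hε hε2 hθ0 hθ hνθ
      hn hnN (hcfl n hn hnN)) (by lia : 1 ≤ N) le_rfl
  have hK : ∀ a : ℝ, a * ((√μ + ε) / (2 - √μ)) * (√μ / 2 * ((2 + ε) / (√μ + ε))
      - 3 * |ν j - EnsembleNS.nuBar ν| / (2 * EnsembleNS.nuBar ν)) =
      a * EnsembleNS.dissipationCoeff (√μ) ε θ := fun a => by
    rw [EnsembleNS.dissipationCoeff, hνθ, mul_assoc, ← mul_div_mul_left (3 * θ) 2 hnb.ne',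
      mul_left_comm 3, mul_comm 2 (EnsembleNS.nuBar ν)]
  rw [hK, show Δt * |ν j - EnsembleNS.nuBar ν| / 2 = EnsembleNS.nuBar ν * Δt * (θ / 2) by
    rw [hνθ]; ring]
  have hdrop : 0 ≤ EnsembleNS.nuBar ν * Δt * (θ / 2) * EnsembleNS.gradNorm (u j (N - 1)) ^ 2 := by
    positivity
  simp only [EnsembleNS.discreteEnergy, ← Finset.mul_sum (Finset.Icc 1 (N - 1)) _ (1 / 8 : ℝ),
    Nat.sub_self] at hsum
  linarith
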